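/- **Proposition 1 (Permutationally invariant states).** Let $N\ge 0$ and let $\mathcal H=(\mathbb C^2)^{\otimes N}$ with standard basis $|i_1,\dots,i_N\rangle$. For $\pi\in S_N$ let $V(\pi)|i_1,\dots,i_N\rangle=|i_{\pi^{-1}(1)},\dots,i_{\pi^{-1}(N)}\rangle$, and for an operator $\rho$ on $\mathcal H$ put $$[\rho]_{\rm PI}=\frac1{N!}\sum_{\pi\in S_N}V(\pi)\,\rho\,V(\pi)^\dagger .$$ An operator is called permutationally invariant if it is of the form $[\rho]_{\rm PI}$ for some operator $\rho$; it is a permutationally invariant state if $\rho$ can be taken to be a density operator (positive semidefinite of trace one). Let $J_\pm=\sum_{n}\sigma_{\pm;n}$ and $J_z=\frac12\sum_n\sigma_{z;n}$ be the collective spin operators (with $\sigma_-=|1\rangle\langle 0|$, $\sigma_+=|0\rangle\langle 1|$). For $j=j_{\min},j_{\min}+1,\dots,N/2$, with $j_{\min}\in\{0,\tfrac12\}$ according to the parity of $N$, let $\mathcal H_j=\mathbb C^{2j+1}$ with orthonormal basis $|j,m\rangle$, $m=j,j-1,\dots,-j$, and let $\mathcal K_j=\{v\in\mathcal H: J_+v=0,\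 J_zv=jv\}$. Choose any orthonormal basis $|j,j,\alpha\rangle$, $\alpha=1,\dots,\dim\mathcal K_j$, of each $\mathcal K_j$, and let $|j,m,\alpha\rangle$ be the normalization of $J_-^{\,j-m}|j,j,\alpha\rangle$. Then the following hold. 1. Every $\mathcal K_j$ is nonzero, and $|j,m\rangle\otimes|\alpha\rangle\mapsto|j,m,\alpha\rangle$ defines a unitary map $\bigoplus_{j}\mathcal H_j\otimes\mathcal K_j\to(\mathbb C^2)^{\otimes N}$. The two spaces are identified through it below. 2. Every permutationally invariant state $\rho_{\rm PI}$ can be written as $$\rho_{\rm PI}=\bigoplus_{j=j_{\min}}^{N/2}p_j\,\rho_j\otimes\frac{\mathbb 1}{\dim(\mathcal K_j)}$$ with density operators $\rho_j$ on $\mathcal H_j$ and a probability distribution $(p_j)$. 3. It is fully characterized by the ensemble $(p_j\rho_j)_j$: every permutationally invariant operator equals $\bigoplus_j X_j\otimes\mathbb 1/\dim(\mathcal K_j)$ for exactly one family of operators $X_j$ on $\mathcal H_j$, and every operator of this form is permutationally invariant. 4. A permutationally invariant operator is a density operator if and only if it equals $\bigoplus_j p_j\rho_j\otimes\mathbb 1/\dim(\mathcal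 K_j)$ for some density operators $\rho_j$ on $\mathcal H_j$ and some probability distribution $(p_j)$. Moreover, for any given real numbers $p_j$ and operators $\rho_j$ on $\mathcal H_j$ with $\operatorname{tr}\rho_j=1$, the operator $\bigoplus_j p_j\rho_j\otimes\mathbb 1/\dim(\mathcal K_j)$ is a density operator if and only if $(p_j)$ is a probability distribution and $\rho_j$ is a density operator for every $j$ with $p_j\ne0$. -/

import Mathlib

open scoped Matrix Kronecker ComplexOrder

/-- Labels of the computational basis `|i₁, …, i_N⟩` of `N` qubits. -/
abbrev QIdx (N : ℕ) : Type := Fin N → Fin 2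

/-- The Hilbert space `(ℂ²)^{⊗N}`, in the orthonormal basis `|i₁, …, i_N⟩`. -/
abbrev QSpace (N : ℕ) : Type := EuclideanSpace ℂ (QIdx N)

/-- Operators on `(ℂ²)^{⊗N}`. -/
abbrev QOp (N : ℕ) : Type := Matrix (QIdx N) (QIdx N) ℂ

/-- Density operators: positive semidefinite with trace one. -/
def IsDensity {ι : Type*} [Fintype ι] (ρ : Matrix ι ι ℂ) : Prop :=
  ρ.PosSemidef ∧ ρ.trace = 1

/-- Probability distributions on a finite set. -/
def IsProbDist {ι : Type*} [Fintype ι] (p : ι → ℝ) : Prop :=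
  (∀ i, 0 ≤ p i) ∧ ∑ i, p i = 1

/-- The operator `V(π)` permuting the qubits:
`V(π)|i₁, …, i_N⟩ = |i_{π⁻¹(1)}, …, i_{π⁻¹(N)}⟩`. -/
def permOp {N : ℕ} (π : Equiv.Perm (Fin N)) : QOp N :=
  Matrix.of fun x y => if x = y ∘ ⇑π⁻¹ then 1 else 0

/-- The permutationally invariant part `[ρ]_PI = (1/N!) ∑_π V(π) ρ V(π)†`. -/
noncomputable def piPart {N : ℕ} (ρ : QOp N) : QOp N :=
  ((N.factorial : ℂ)⁻¹) • ∑ π : Equiv.Perm (Fin N), permOp π * ρ * (permOp π)ᴴ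

/-- Permutationally invariant operators. -/
def IsPI {N : ℕ} (A : QOp N) : Prop := ∃ ρ : QOp N, A = piPart ρ

/-- The one-qubit operator `a` acting on qubit `n`, with the identity on the other qubits. -/
def siteOp {N : ℕ} (n : Fin N) (a : Matrix (Fin 2) (Fin 2) ℂ) : QOp N :=
  Matrix.of fun x y => if ∀ l, l ≠ n → x l = y l then a (x n) (y n) else 0

/-- The collective ladder operator `J₋ = ∑ₙ σ_{-;n}`, where `σ₋ = |1⟩⟨0|`. -/
def Jminus (N : ℕ) : QOp N := ∑ n, siteOp n !![0, 0; 1, 0]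

/-- The collective ladder operator `J₊ = ∑ₙ σ_{+;n}`, where `σ₊ = |0⟩⟨1|`. -/
def Jplus (N : ℕ) : QOp N := ∑ n, siteOp n !![0, 1; 0, 0]

/-- The collective spin operator `J_z = ∑ₙ σ_{z;n} / 2`. -/
noncomputable def Jz (N : ℕ) : QOp N := ∑ n, siteOp n !![1 / 2, 0; 0, -(1 / 2)]

/-- The total spin numbers `j = j_min, j_min + 1, …, N/2`, encoded by the integer `2j`. -/
abbrev SpinLabel (N : ℕ) : Type := {d : Fin (N + 1) // (d : ℕ) % 2 = N % 2}

/-- The integer `2j`. -/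
abbrev SpinLabel.two {N : ℕ} (j : SpinLabel N) : ℕ := (j.1 : ℕ)

/-- Operators on the spin space `H_j = ℂ^{2j+1}`, as matrices in the basis `|j,m⟩`;
the index `i = 0, …, 2j` stands for `m = j - i`. -/
abbrev SpinOp {N : ℕ} (j : SpinLabel N) : Type :=
  Matrix (Fin (j.two + 1)) (Fin (j.two + 1)) ℂ

/-- The multiplicity space `K_j`, realised as the space of the states of total spin `j` with
largest spin projection `m = j`, that is, `J₊ v = 0` and `J_z v = j v`. -/
noncomputable def multSpace {N : ℕ} (j : SpinLabel N) : Submodule ℂ (QSpace N) :=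
  LinearMap.ker (Matrix.toEuclideanLin (Jplus N)) ⊓
    Module.End.eigenspace (Matrix.toEuclideanLin (Jz N)) ((j.two : ℂ) / 2)

/-- `dim K_j`. -/
noncomputable abbrev multDim {N : ℕ} (j : SpinLabel N) : ℕ :=
  Module.finrank ℂ (multSpace j)

/-- A choice of an orthonormal basis `|j,j,α⟩`, `α = 1, …, dim K_j`, of every `K_j`. -/
abbrev MultBases (N : ℕ) : Type :=
  ∀ j : SpinLabel N, OrthonormalBasis (Fin (multDim j)) ℂ (multSpace j)

/-- Labels `(j, (m, α))` of the product basis of `⨁_j H_j ⊗ K_j`. -/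
abbrev SpinIdx (N : ℕ) : Type :=
  (j : SpinLabel N) × (Fin (j.two + 1) × Fin (multDim j))

/-- The spin state `|j,m,α⟩`: the vector `J₋^{j-m} |j,j,α⟩`, normalised. -/
noncomputable def spinState {N : ℕ} (b : MultBases N) (s : SpinIdx N) : QSpace N :=
  let w : QSpace N :=
    Matrix.toEuclideanLin (Jminus N ^ (s.2.1 : ℕ)) (b s.1 s.2.2 : QSpace N)
  ((‖w‖⁻¹ : ℝ) : ℂ) • w

/-- The linear map `⨁_j H_j ⊗ K_j → (ℂ²)^{⊗N}` that sends the basis vector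
`|j,m⟩ ⊗ |α⟩` to the spin state `|j,m,α⟩`, as a matrix. -/
noncomputable def spinMap {N : ℕ} (b : MultBases N) : Matrix (QIdx N) (SpinIdx N) ℂ :=
  Matrix.of fun x s => spinState b s x

/-- The operator `⨁_j X_j ⊗ 𝟙 / dim K_j`, transported to `(ℂ²)^{⊗N}`. -/
noncomputable def blockSum {N : ℕ} (b : MultBases N) (X : ∀ j : SpinLabel N, SpinOp j) :
    QOp N :=
  spinMap b *
    Matrix.blockDiagonal' (fun j : SpinLabel N =>
      X j ⊗ₖ (((multDim j : ℂ)⁻¹) • (1 : Matrix (Fin (multDim j)) (Fin (multDim j)) ℂ))) *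
    (spinMap b)ᴴ

/-! ### Collective spin operators and their commutation relations. -/

section SiteOperators

variable {N : ℕ}

/-! The proof combines the representation theory of one spin algebra with a dimension count, and
needs neither Schur's lemma nor the double commutant theorem.

The collective operators satisfy the spin relations and `Jplus` is the adjoint of `Jminus`. Hence
`Jminus ^ k` multiplies inner products of highest weight vectors of spin j by a scalar depending
only on j and k, so the lowered and normalized bases of the K_j are orthonormal
(`orthonormal_spinState`). They span because, in each weight space, the orthogonal complement of
what is lowered from the weight above is killed by `Jplus` (`weight_mem_span_spinState`). K_j is
nonzero because `Jplus` goes from a weight space of dimension C(N, k) to a strictly smaller one,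
where k = N/2 - j (`multDim_pos`).

Qubit permutations commute with the collective operators, so V(π) acts on the factors K_j only, and
every block sum is invariant (`blockSum_mem_invariantOps`). Conversely, an invariant operator is
determined by one entry for each N-element multiset of letter pairs (x i, y i), so the invariant
operators have dimension at most C(N+3, 3). This equals ∑ (2j+1)², the dimension of the families
(X_j). As X ↦ `blockSum b X` is injective, it is onto (`exists_eq_blockSum`). Positivity and trace
are then read off block by block. -/

theorem siteOp_mulVec (n : Fin N) (a : Matrix (Fin 2) (Fin 2) ℂ) (v : QIdx N → ℂ) (x : QIdx N) :
    (siteOp n a *ᵥ v) x = ∑ i, a (x n) i * v (Function.update x n i) := by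
  classical
  have hinj : Function.Injective (fun i : Fin 2 => Function.update x n i) := fun i j h => by
    simpa using congrFun h n
  have hmap : ∑ i, a (x n) i * v (Function.update x n i) =
      ∑ y ∈ Finset.univ.map ⟨_, hinj⟩, a (x n) (y n) * v y := by
    simp
  simp only [hmap, Matrix.mulVec, dotProduct, siteOp, Matrix.of_apply]
  symm
  rw [← Finset.sum_subset (Finset.subset_univ _)]
  · refine Finset.sum_congr rfl fun y hy => ?_
    obtain ⟨i, -, rfl⟩ := Finset.mem_map.1 hy
    rw [if_pos]
    intro l hl
    simp [hl]
  · intro y _ hy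
    rw [if_neg, zero_mul]
    intro h
    refine hy (Finset.mem_map.2 ⟨y n, Finset.mem_univ _, ?_⟩)
    ext l
    by_cases hl : l = n
    · subst hl; simp
    · simp [hl, h l hl]

theorem siteOp_mul_siteOp_self (n : Fin N) (a b : Matrix (Fin 2) (Fin 2) ℂ) :
    siteOp n a * siteOp n b = siteOp n (a * b) := by
  refine Matrix.mulVec_injective (funext fun v => funext fun x => ?_)
  rw [← Matrix.mulVec_mulVec]
  simp only [siteOp_mulVec, Matrix.mul_apply, Fin.sum_univ_two, Function.update_self,
    Function.update_idem]
  ring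

theorem siteOp_commute {n m : Fin N} (h : n ≠ m) (a b : Matrix (Fin 2) (Fin 2) ℂ) :
    siteOp n a * siteOp m b = siteOp m b * siteOp n a := by
  refine Matrix.mulVec_injective (funext fun v => funext fun x => ?_)
  rw [← Matrix.mulVec_mulVec, ← Matrix.mulVec_mulVec]
  simp only [siteOp_mulVec, Fin.sum_univ_two, Function.update_of_ne h, Function.update_of_ne h.symm,
    Function.update_comm h]
  ring

theorem siteOp_sub (n : Fin N) (a b : Matrix (Fin 2) (Fin 2) ℂ) :
    siteOp n (a - b) = siteOp n a - siteOp n b := by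
  ext x y
  simp only [siteOp, Matrix.of_apply, Matrix.sub_apply]
  split_ifs <;> simp

theorem siteOp_smul (n : Fin N) (c : ℂ) (a : Matrix (Fin 2) (Fin 2) ℂ) :
    siteOp n (c • a) = c • siteOp n a := by
  ext x y
  simp only [siteOp, Matrix.of_apply, Matrix.smul_apply]
  split_ifs <;> simp

theorem siteOp_conjTranspose (n : Fin N) (a : Matrix (Fin 2) (Fin 2) ℂ) :
    (siteOp n a)ᴴ = siteOp n aᴴ := by
  ext x y
  have : (∀ l, l ≠ n → x l = y l) ↔ (∀ l, l ≠ n → y l = x l) := by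
    simp only [eq_comm]
  simp only [siteOp, Matrix.of_apply, Matrix.conjTranspose_apply, this]
  split_ifs <;> simp

/-- The commutator of two collective operators is the collective commutator. -/
theorem sum_siteOp_commutator (a b : Matrix (Fin 2) (Fin 2) ℂ) :
    (∑ n : Fin N, siteOp n a) * (∑ n, siteOp n b) - (∑ n, siteOp n b) * (∑ n, siteOp n a) =
      ∑ n, siteOp n (a * b - b * a) := by
  have key : ∀ n m : Fin N, siteOp n a * siteOp m b - siteOp m b * siteOp n a =
      if n = m then siteOp n (a * b - b * a) else 0 := by
    intro n m
    split_ifs with h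
    · subst h
      rw [siteOp_mul_siteOp_self, siteOp_mul_siteOp_self, siteOp_sub]
    · rw [siteOp_commute h, sub_self]
  calc _ = ∑ n : Fin N, ∑ m, (siteOp n a * siteOp m b - siteOp m b * siteOp n a) := by
        simp only [Finset.sum_sub_distrib, ← Finset.mul_sum, ← Finset.sum_mul]
    _ = _ := by simp [key]

theorem Jplus_mul_Jminus_sub :
    Jplus N * Jminus N - Jminus N * Jplus N = (2 : ℂ) • Jz N := by
  rw [Jplus, Jminus, sum_siteOp_commutator, Jz, Finset.smul_sum]
  refine Finset.sum_congr rfl fun n _ => ?_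
  rw [← siteOp_smul]
  congr 1
  ext i j; fin_cases i <;> fin_cases j <;> simp

theorem Jz_mul_Jminus_sub : Jz N * Jminus N - Jminus N * Jz N = -Jminus N := by
  rw [Jz, Jminus, sum_siteOp_commutator, ← neg_one_smul ℂ (∑ n, siteOp n _), Finset.smul_sum]
  refine Finset.sum_congr rfl fun n _ => ?_
  rw [← siteOp_smul]
  congr 1
  ext i j; fin_cases i <;> fin_cases j <;> norm_num

theorem Jz_mul_Jplus_sub : Jz N * Jplus N - Jplus N * Jz N = Jplus N := by
  rw [Jz, Jplus, sum_siteOp_commutator]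
  refine Finset.sum_congr rfl fun n _ => ?_
  congr 1
  ext i j; fin_cases i <;> fin_cases j <;> norm_num

theorem Jplus_conjTranspose : (Jplus N)ᴴ = Jminus N := by
  rw [Jplus, Jminus, Matrix.conjTranspose_sum]
  refine Finset.sum_congr rfl fun n _ => ?_
  rw [siteOp_conjTranspose]
  congr 1
  ext i j; fin_cases i <;> fin_cases j <;> simp

theorem Jz_conjTranspose : (Jz N)ᴴ = Jz N := by
  rw [Jz, Matrix.conjTranspose_sum]
  refine Finset.sum_congr rfl fun n _ => ?_
  rw [siteOp_conjTranspose]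
  congr 1
  ext i j; fin_cases i <;> fin_cases j <;> simp

/-- The number of qubits in the state `|1⟩`. -/
def excitations (x : QIdx N) : ℕ := (Finset.univ.filter fun n => x n = 1).card

theorem Jz_mulVec (v : QIdx N → ℂ) (x : QIdx N) :
    (Jz N *ᵥ v) x = ((N : ℂ) / 2 - excitations x) * v x := by
  rw [Jz, Matrix.sum_mulVec, Finset.sum_apply]
  have key : ∀ n : Fin N, (siteOp n !![1 / 2, 0; 0, -(1 / 2)] *ᵥ v) x =
      (1 / 2 - if x n = 1 then 1 else 0) * v x := by
    intro n
    rw [siteOp_mulVec]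
    have hu := Function.update_eq_self n x
    rcases (by omega : x n = 0 ∨ x n = 1) with h | h
    · rw [h] at hu
      simp [h, hu]
    · rw [h] at hu
      simp [h, hu]
      ring_nf
  rw [Finset.sum_congr rfl fun n _ => key n, ← Finset.sum_mul, Finset.sum_sub_distrib]
  simp [excitations, div_eq_mul_inv]

end SiteOperators

/-! ### Highest weight theory with inner products. -/

section Ladder

variable {E : Type*} [NormedAddCommGroup E] [InnerProductSpace ℂ E]

/-- A unitary representation of the spin algebra: the raising operator `e`, the lowering operator
`f` and the spin projection `h`. -/
structure IsSpinTriple (e f h : E →ₗ[ℂ] E) : Prop where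
  inner_left : ∀ v w, inner ℂ (e v) w = inner ℂ v (f w)
  symm : ∀ v w, inner ℂ (h v) w = inner ℂ v (h w)
  ef : ∀ v, e (f v) = f (e v) + (2 : ℂ) • h v
  hf : ∀ v, h (f v) = f (h v) - f v
  he : ∀ v, h (e v) = e (h v) + e v

namespace IsSpinTriple

variable {e f h : E →ₗ[ℂ] E}

theorem inner_right (T : IsSpinTriple e f h) (v w : E) : inner ℂ (f v) w = inner ℂ v (e w) := by
  rw [← inner_conj_symm, ← T.inner_left, inner_conj_symm]

theorem inner_eq_zero_of_ne (T : IsSpinTriple e f h) {a b : ℂ} {v w : E} (hv : h v = a • v) (hw : h w = b • w)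
    (hab : (starRingEnd ℂ) a ≠ b) : inner ℂ v w = 0 := by
  have := T.symm v w
  rw [hv, hw, inner_smul_left, inner_smul_right] at this
  rcases mul_eq_mul_right_iff.1 this with h | h
  · exact absurd h hab
  · exact h

theorem h_lower (T : IsSpinTriple e f h) {a : ℂ} {v : E} (hv : h v = a • v) (k : ℕ) :
    h ((f ^ k) v) = (a - k) • (f ^ k) v := by
  induction k with
  | zero => simpa using hv
  | succ k ih =>
    rw [pow_succ', Module.End.mul_apply, T.hf, ih, map_smul]
    push_cast; module

theorem h_raise (T : IsSpinTriple e f h) {a : ℂ} {v : E} (hv : h v = a • v) :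
    h (e v) = (a + 1) • e v := by
  rw [T.he, hv, map_smul]
  module

/-- Moving `e` past each `f` adds twice the current weight; the coefficient is the sum of 2(a - i)
over i ≤ k. -/
theorem raise_lower (T : IsSpinTriple e f h) {a : ℂ} {v : E} (hv : h v = a • v) (hev : e v = 0) (k : ℕ) :
    e ((f ^ (k + 1)) v) = ((k + 1) * (2 * a - k)) • (f ^ k) v := by
  induction k with
  | zero => simp [T.ef, hev, hv, smul_smul]
  | succ k ih =>
    rw [pow_succ', Module.End.mul_apply, T.ef, ih, T.h_lower hv, map_smul, smul_smul,
      ← Module.End.mul_apply, ← pow_succ', ← add_smul]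
    push_cast; ring_nf

theorem inner_lower_succ (T : IsSpinTriple e f h) {a : ℂ} {v w : E} (hw : h w = a • w) (hew : e w = 0) (k l : ℕ) :
    inner ℂ ((f ^ (k + 1)) v) ((f ^ (l + 1)) w) =
      ((l + 1) * (2 * a - l)) * inner ℂ ((f ^ k) v) ((f ^ l) w) := by
  rw [pow_succ' f k, Module.End.mul_apply, T.inner_right, T.raise_lower hw hew, inner_smul_right]

/-- Cancelling one `f` on both sides lowers both exponents until one is zero; the remaining `f` then
moves across as an `e` that kills a highest weight vector. The two weights may differ, so strings of
different spin are covered. -/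
theorem inner_lower_of_ne (T : IsSpinTriple e f h) {a : ℂ} {v w : E} (hev : e v = 0)
    (hw : h w = a • w) (hew : e w = 0) {k l : ℕ} (hkl : k ≠ l) :
    inner ℂ ((f ^ k) v) ((f ^ l) w) = 0 := by
  induction k generalizing l with
  | zero =>
    obtain ⟨l, rfl⟩ := Nat.exists_eq_succ_of_ne_zero hkl.symm
    rw [pow_zero, Module.End.one_apply, Nat.succ_eq_add_one, pow_succ', Module.End.mul_apply,
      ← T.inner_left, hev, inner_zero_left]
  | succ k ih =>
    cases l with
    | zero =>
      rw [pow_zero, Module.End.one_apply, pow_succ', Module.End.mul_apply, T.inner_right, hew,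
        inner_zero_right]
    | succ l => rw [T.inner_lower_succ hw hew, ih (by omega), mul_zero]

theorem inner_lower_self (T : IsSpinTriple e f h) {a : ℂ} {v w : E} (hw : h w = a • w) (hew : e w = 0) (k : ℕ) :
    inner ℂ ((f ^ k) v) ((f ^ k) w) =
      (∏ i ∈ Finset.range k, ((i + 1) * (2 * a - i) : ℂ)) * inner ℂ v w := by
  induction k with
  | zero => simp
  | succ k ih => rw [T.inner_lower_succ hw hew, ih, Finset.prod_range_succ]; ring

/-- The weight of a nonzero highest weight vector is nonnegative. -/
theorem weight_nonneg (T : IsSpinTriple e f h) {a : ℝ} {v : E} (hv : h v = (a : ℂ) • v) (hev : e v = 0) (h0 : v ≠ 0) :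
    0 ≤ a := by
  -- This is ‖f v‖² = 2a‖v‖².
  have h1 := T.inner_lower_succ hv hev (v := v) 0 0
  simp only [zero_add, pow_one, pow_zero, Module.End.one_apply, inner_self_eq_norm_sq_to_K] at h1
  norm_cast at h1
  have h2 : 0 < ‖v‖ ^ 2 := by positivity
  have h3 : (0 : ℝ) ≤ ‖f v‖ ^ 2 := by positivity
  have h4 : ‖f v‖ ^ 2 = 2 * a * ‖v‖ ^ 2 := by
    have := congrArg Complex.re h1
    simpa [← Complex.ofReal_pow] using this
  by_contra hneg
  nlinarith

end IsSpinTriple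

end Ladder

/-! ### The spin states form an orthonormal basis. -/

section SpinBasis

variable {N : ℕ}

theorem inner_toEuclideanLin_left (A : QOp N) (v w : QSpace N) :
    inner ℂ (Matrix.toEuclideanLin A v) w = inner ℂ v (Matrix.toEuclideanLin Aᴴ w) := by
  rw [Matrix.toEuclideanLin_conjTranspose_eq_adjoint, LinearMap.adjoint_inner_right]

theorem toEuclideanLin_mul_apply (A B : QOp N) (v : QSpace N) :
    Matrix.toEuclideanLin (A * B) v = Matrix.toEuclideanLin A (Matrix.toEuclideanLin B v) := by
  rw [Matrix.toEuclideanLin, Matrix.toLpLin_mul_same]; rfl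

theorem isSpinTriple_collective (N : ℕ) :
    IsSpinTriple (Matrix.toEuclideanLin (Jplus N)) (Matrix.toEuclideanLin (Jminus N))
      (Matrix.toEuclideanLin (Jz N)) where
  inner_left v w := by rw [inner_toEuclideanLin_left, Jplus_conjTranspose]
  symm v w := by rw [inner_toEuclideanLin_left, Jz_conjTranspose]
  ef v := by
    rw [← toEuclideanLin_mul_apply, ← toEuclideanLin_mul_apply,
      eq_add_of_sub_eq (Jplus_mul_Jminus_sub (N := N)), add_comm]
    simp only [map_add, map_smul, LinearMap.add_apply, LinearMap.smul_apply]
  hf v := by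
    rw [← toEuclideanLin_mul_apply, ← toEuclideanLin_mul_apply,
      eq_add_of_sub_eq (Jz_mul_Jminus_sub (N := N))]
    simp only [map_add, map_neg, LinearMap.add_apply, LinearMap.neg_apply]
    abel
  he v := by
    rw [← toEuclideanLin_mul_apply, ← toEuclideanLin_mul_apply,
      eq_add_of_sub_eq (Jz_mul_Jplus_sub (N := N))]
    simp only [map_add, LinearMap.add_apply]
    abel

theorem mem_multSpace {j : SpinLabel N} {v : QSpace N} :
    v ∈ multSpace j ↔ Matrix.toEuclideanLin (Jplus N) v = 0 ∧
      Matrix.toEuclideanLin (Jz N) v = ((j.two : ℂ) / 2) • v := by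
  rw [multSpace, Submodule.mem_inf, LinearMap.mem_ker, Module.End.mem_eigenspace_iff]

/-- The squared norm of `J₋ᵏ v` for a unit highest weight vector `v` of weight `d / 2`. -/
noncomputable def ladderNormSq (d k : ℕ) : ℝ :=
  ∏ i ∈ Finset.range k, (((i : ℝ) + 1) * (d - i))

theorem ladderNormSq_pos {d k : ℕ} (h : k ≤ d) : 0 < ladderNormSq d k := by
  refine Finset.prod_pos fun i hi => ?_
  have : (i : ℝ) < d := by
    have := Finset.mem_range.1 hi
    exact_mod_cast lt_of_lt_of_le this h
  have := sub_pos.2 this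
  positivity

theorem ladderNormSq_eq_zero {d k : ℕ} (h : d < k) : ladderNormSq d k = 0 :=
  Finset.prod_eq_zero (Finset.mem_range.2 h) (by simp)

theorem inner_lower_multSpace {j : SpinLabel N} {v w : QSpace N} (hw : w ∈ multSpace j) (k : ℕ) :
    inner ℂ (Matrix.toEuclideanLin (Jminus N ^ k) v) (Matrix.toEuclideanLin (Jminus N ^ k) w) =
      (ladderNormSq j.two k : ℂ) * inner ℂ v w := by
  obtain ⟨h1, h2⟩ := mem_multSpace.1 hw
  rw [Matrix.toEuclideanLin, Matrix.toLpLin_pow,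
    (isSpinTriple_collective N).inner_lower_self h2 h1, ladderNormSq]
  congr 1
  push_cast
  refine Finset.prod_congr rfl fun i _ => ?_
  ring

theorem inner_lower_multSpace_of_ne {i j : SpinLabel N} {v w : QSpace N} (hv : v ∈ multSpace i)
    (hw : w ∈ multSpace j) {k l : ℕ} (hkl : k ≠ l) :
    inner ℂ (Matrix.toEuclideanLin (Jminus N ^ k) v) (Matrix.toEuclideanLin (Jminus N ^ l) w) =
      0 := by
  obtain ⟨h1, h2⟩ := mem_multSpace.1 hw
  rw [Matrix.toEuclideanLin, Matrix.toLpLin_pow, Matrix.toLpLin_pow]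
  exact (isSpinTriple_collective N).inner_lower_of_ne (mem_multSpace.1 hv).1 h2 h1 hkl

theorem inner_multSpace_of_ne {i j : SpinLabel N} (hij : i ≠ j) {v w : QSpace N}
    (hv : v ∈ multSpace i) (hw : w ∈ multSpace j) : inner ℂ v w = 0 := by
  refine (isSpinTriple_collective N).inner_eq_zero_of_ne (mem_multSpace.1 hv).2
    (mem_multSpace.1 hw).2 fun h => hij ?_
  have : (i.two : ℂ) = j.two := by
    rw [map_div₀, Complex.conj_ofNat, Complex.conj_natCast] at h
    exact (div_left_inj' two_ne_zero).1 h
  exact Subtype.ext (Fin.ext (by exact_mod_cast this))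

theorem norm_lower_multSpace {j : SpinLabel N} {v : QSpace N} (hv : v ∈ multSpace j) (k : ℕ) :
    ‖Matrix.toEuclideanLin (Jminus N ^ k) v‖ ^ 2 = ladderNormSq j.two k * ‖v‖ ^ 2 := by
  have h := inner_lower_multSpace (v := v) hv k
  rw [inner_self_eq_norm_sq_to_K, inner_self_eq_norm_sq_to_K] at h
  apply Complex.ofReal_injective
  push_cast
  exact h

theorem norm_lower_basis (b : MultBases N) (j : SpinLabel N) (α : Fin (multDim j)) (k : ℕ) :
    ‖Matrix.toEuclideanLin (Jminus N ^ k) (b j α : QSpace N)‖ = √(ladderNormSq j.two k) := by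
  have hb : ‖(b j α : QSpace N)‖ = 1 := (b j).orthonormal.1 α
  rw [← Real.sqrt_sq (norm_nonneg _), norm_lower_multSpace (b j α).2, hb]
  simp

theorem spinState_eq (b : MultBases N) (j : SpinLabel N) (k : Fin (j.two + 1))
    (α : Fin (multDim j)) :
    spinState b ⟨j, k, α⟩ = (((√(ladderNormSq j.two k))⁻¹ : ℝ) : ℂ) •
      Matrix.toEuclideanLin (Jminus N ^ (k : ℕ)) (b j α : QSpace N) := by
  rw [spinState]
  simp only [norm_lower_basis]

theorem inner_basis (b : MultBases N) (j : SpinLabel N) (α β : Fin (multDim j)) :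
    inner ℂ (b j α : QSpace N) (b j β : QSpace N) = if α = β then 1 else 0 := by
  rw [← Submodule.coe_inner]
  exact orthonormal_iff_ite.1 (b j).orthonormal α β

theorem orthonormal_spinState (b : MultBases N) : Orthonormal ℂ (spinState b) := by
  rw [orthonormal_iff_ite]
  rintro ⟨i, k, α⟩ ⟨j, l, β⟩
  rw [spinState_eq, spinState_eq, inner_smul_left, inner_smul_right]
  by_cases hkl : (k : ℕ) = l
  · rw [hkl, inner_lower_multSpace (b j β).2]
    by_cases hij : i = j
    · subst hij
      have hkl' : k = l := Fin.ext hkl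
      subst hkl'
      have hpos := ladderNormSq_pos (Nat.lt_succ_iff.1 k.2)
      rw [inner_basis]
      by_cases hαβ : α = β
      · subst hαβ
        rw [if_pos rfl, if_pos rfl, mul_one, Complex.conj_ofReal]
        norm_cast
        rw [← mul_assoc, ← mul_inv, Real.mul_self_sqrt hpos.le, inv_mul_cancel₀ hpos.ne']
      · rw [if_neg hαβ, if_neg (by simp [hαβ])]
        simp
    · rw [inner_multSpace_of_ne hij (b i α).2 (b j β).2, if_neg]
      · simp
      · intro h
        exact hij (congrArg Sigma.fst h)
  · rw [inner_lower_multSpace_of_ne (b i α).2 (b j β).2 hkl, if_neg]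
    · simp
    · intro h
      refine hkl ?_
      exact congrArg (fun s : SpinIdx N => (s.2.1 : ℕ)) h

/-- A highest weight vector lies in one of the spaces `K_j`. -/
theorem highestWeight_mem_multSpace {v : QSpace N} {k : ℕ}
    (hz : Matrix.toEuclideanLin (Jz N) v = ((N : ℂ) / 2 - k) • v)
    (hp : Matrix.toEuclideanLin (Jplus N) v = 0) (h0 : v ≠ 0) :
    ∃ j : SpinLabel N, v ∈ multSpace j := by
  have hz' : Matrix.toEuclideanLin (Jz N) v = (((N : ℝ) / 2 - k : ℝ) : ℂ) • v := by
    rw [hz]; push_cast; rfl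
  have h := (isSpinTriple_collective N).weight_nonneg hz' hp h0
  have hk : 2 * k ≤ N := by
    have : (2 * k : ℝ) ≤ N := by linarith
    exact_mod_cast this
  -- 2j = N - 2k; the subtraction is not truncated, since highest weights are nonnegative.
  refine ⟨⟨⟨N - 2 * k, by omega⟩, by simp only; omega⟩, mem_multSpace.2 ⟨hp, ?_⟩⟩
  rw [hz]
  congr 1
  simp only [SpinLabel.two]
  rw [Nat.cast_sub hk]
  push_cast
  ring

/-- For k ≤ 2j the vector is a combination of spin states; beyond that the factor d - i at i = d
makes its norm vanish. -/
theorem lower_mem_span_spinState (b : MultBases N) {j : SpinLabel N} {v : QSpace N}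
    (hv : v ∈ multSpace j) (k : ℕ) :
    Matrix.toEuclideanLin (Jminus N ^ k) v ∈ Submodule.span ℂ (Set.range (spinState b)) := by
  rcases lt_or_ge j.two k with hk | hk
  · have h := norm_lower_multSpace hv k
    rw [ladderNormSq_eq_zero hk, zero_mul, sq_eq_zero_iff, norm_eq_zero] at h
    rw [h]
    exact Submodule.zero_mem _
  · have hsum : v = ∑ α, (b j).repr ⟨v, hv⟩ α • (b j α : QSpace N) := by
      have := congrArg Subtype.val ((b j).sum_repr ⟨v, hv⟩)
      simpa using this.symm
    rw [hsum, map_sum]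
    refine Submodule.sum_mem _ fun α _ => ?_
    rw [map_smul]
    refine Submodule.smul_mem _ _ ?_
    have hmem : spinState b ⟨j, ⟨k, Nat.lt_succ_of_le hk⟩, α⟩ ∈
        Submodule.span ℂ (Set.range (spinState b)) := Submodule.subset_span ⟨_, rfl⟩
    rw [spinState_eq] at hmem
    refine (Submodule.smul_mem_iff _ ?_).1 hmem
    have := Real.sqrt_pos.2 (ladderNormSq_pos hk)
    exact_mod_cast (inv_pos.2 this).ne'

theorem Jminus_mem_span_spinState (b : MultBases N) {v : QSpace N}
    (hv : v ∈ Submodule.span ℂ (Set.range (spinState b))) :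
    Matrix.toEuclideanLin (Jminus N) v ∈ Submodule.span ℂ (Set.range (spinState b)) := by
  induction hv using Submodule.span_induction with
  | mem x hx =>
    obtain ⟨⟨j, k, α⟩, rfl⟩ := hx
    rw [spinState_eq, map_smul, ← toEuclideanLin_mul_apply, ← pow_succ']
    exact Submodule.smul_mem _ _ (lower_mem_span_spinState b (b j α).2 _)
  | zero => rw [map_zero]; exact Submodule.zero_mem _
  | add x y _ _ hx hy => rw [map_add]; exact Submodule.add_mem _ hx hy
  | smul a x _ hx => rw [map_smul]; exact Submodule.smul_mem _ _ hx

/-- `Jz` is diagonal, so an eigenvector is supported on words with one fixed excitation number. -/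
theorem Jz_eigenvector_apply {v : QSpace N} {a : ℂ}
    (hv : Matrix.toEuclideanLin (Jz N) v = a • v) (x : QIdx N) (hx : v x ≠ 0) :
    a = (N : ℂ) / 2 - excitations x := by
  have h : (Jz N *ᵥ v.ofLp) x = a * v x := by
    have := congrArg (fun w : QSpace N => w x) hv
    simpa [Matrix.toLpLin_apply] using this
  rw [Jz_mulVec] at h
  exact (mul_right_cancel₀ hx h).symm

/-- Induction down the weights, starting from the top weight N/2. -/
theorem weight_mem_span_spinState (b : MultBases N) (k : ℕ) {v : QSpace N}
    (hv : Matrix.toEuclideanLin (Jz N) v = ((N : ℂ) / 2 - k) • v) :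
    v ∈ Submodule.span ℂ (Set.range (spinState b)) := by
  have T := isSpinTriple_collective N
  have highest : ∀ {v : QSpace N} {k : ℕ},
      Matrix.toEuclideanLin (Jz N) v = ((N : ℂ) / 2 - k) • v →
      Matrix.toEuclideanLin (Jplus N) v = 0 →
      v ∈ Submodule.span ℂ (Set.range (spinState b)) := by
    intro v k hz hp
    by_cases h0 : v = 0
    · rw [h0]; exact Submodule.zero_mem _
    · obtain ⟨j, hj⟩ := highestWeight_mem_multSpace hz hp h0
      simpa [Matrix.toEuclideanLin] using lower_mem_span_spinState b hj 0
  induction k generalizing v with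
  | zero =>
    refine highest hv ?_
    ext x
    by_contra hx
    -- Weight N/2 + 1 would require an excitation number of -1.
    have h' := Jz_eigenvector_apply (T.h_raise hv) x hx
    rw [Nat.cast_zero] at h'
    have h2 : ((excitations x + 1 : ℕ) : ℂ) = 0 := by
      push_cast
      linear_combination h'
    exact absurd h2 (Nat.cast_ne_zero.2 (Nat.succ_ne_zero _))
  | succ k ih =>
    -- With V the weight space one level up, v = J₋u + w where u ∈ V and w ⟂ J₋V; the rest shows
    -- that w is a highest weight vector.
    let V := Module.End.eigenspace (Matrix.toEuclideanLin (Jz N)) ((N : ℂ) / 2 - k)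
    obtain ⟨_, ⟨u, hu, rfl⟩, w, hw, hvw⟩ :=
      (V.map (Matrix.toEuclideanLin (Jminus N))).exists_add_mem_mem_orthogonal v
    have hu' := Module.End.mem_eigenspace_iff.1 hu
    have hwz : Matrix.toEuclideanLin (Jz N) w = ((N : ℂ) / 2 - (k + 1 : ℕ)) • w := by
      rw [eq_sub_of_add_eq' hvw.symm, map_sub, hv, T.hf, hu', map_smul]
      push_cast
      module
    rw [hvw]
    refine Submodule.add_mem _ (Jminus_mem_span_spinState b (ih hu')) (highest hwz ?_)
    have hmem : Matrix.toEuclideanLin (Jplus N) w ∈ V := by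
      rw [Module.End.mem_eigenspace_iff, T.h_raise hwz]
      push_cast
      module
    -- ‖J₊w‖² = ⟪J₋J₊w, w⟫, and J₊w ∈ V.
    have h0 : inner ℂ (Matrix.toEuclideanLin (Jplus N) w) (Matrix.toEuclideanLin (Jplus N) w) =
        (0 : ℂ) := by
      rw [← T.inner_right]
      exact (Submodule.mem_orthogonal _ w).1 hw _ ⟨_, hmem, rfl⟩
    exact inner_self_eq_zero.1 h0

theorem span_spinState (b : MultBases N) :
    Submodule.span ℂ (Set.range (spinState b)) = ⊤ := by
  rw [eq_top_iff, ← (EuclideanSpace.basisFun (QIdx N) ℂ).toBasis.span_eq, Submodule.span_le]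
  rintro _ ⟨x, rfl⟩
  refine weight_mem_span_spinState b (excitations x) ?_
  ext y
  simp only [OrthonormalBasis.coe_toBasis, EuclideanSpace.basisFun_apply, Matrix.toLpLin_apply,
    Jz_mulVec, PiLp.smul_apply, smul_eq_mul]
  by_cases h : y = x
  · subst h; rfl
  · simp [h]

theorem spinMap_conjTranspose_mul_spinMap (b : MultBases N) : (spinMap b)ᴴ * spinMap b = 1 := by
  ext s t
  have h := orthonormal_iff_ite.1 (orthonormal_spinState b) s t
  rw [PiLp.inner_apply] at h
  rw [Matrix.mul_apply, Matrix.one_apply, ← h]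
  refine Finset.sum_congr rfl fun x _ => ?_
  simp [spinMap, mul_comm]

/-- The spin states form a basis, so the two index types have equal cardinality and a left inverse
is a right inverse. -/
theorem spinMap_mul_conjTranspose_spinMap (b : MultBases N) : spinMap b * (spinMap b)ᴴ = 1 := by
  refine (Matrix.mul_eq_one_comm_of_card_eq _ _ _ ?_).1 (spinMap_conjTranspose_mul_spinMap b)
  rw [← finrank_euclideanSpace (𝕜 := ℂ) (ι := QIdx N)]
  exact (Module.finrank_eq_card_basis (Module.Basis.mk (orthonormal_spinState b).linearIndependent
    (span_spinState b).ge)).symm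

end SpinBasis

/-! ### Nonvanishing of the multiplicity spaces. -/

section Multiplicity

variable {N : ℕ}

theorem card_excitations_eq (k : ℕ) :
    Fintype.card {x : QIdx N // excitations x = k} = N.choose k := by
  rw [← Finset.card_fin N, ← Finset.card_powersetCard, Finset.card_fin N, Fintype.card_subtype]
  refine Finset.card_bij' (fun x _ => Finset.univ.filter fun n => x n = 1)
    (fun s _ n => if n ∈ s then 1 else 0) ?_ ?_ ?_ ?_
  · intro x hx
    exact Finset.mem_powersetCard.2 ⟨Finset.subset_univ _, (Finset.mem_filter.1 hx).2⟩
  · intro s hs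
    refine Finset.mem_filter.2 ⟨Finset.mem_univ _, ?_⟩
    simpa [excitations] using (Finset.mem_powersetCard.1 hs).2
  · intro x _
    funext n
    rcases (by omega : x n = 0 ∨ x n = 1) with h | h <;> simp [h]
  · intro s _
    ext n
    simp

theorem choose_lt_choose_succ_of_two_mul_lt {n k : ℕ} (h : 2 * (k + 1) ≤ n) :
    n.choose k < n.choose (k + 1) := by
  have h1 := Nat.choose_succ_right_eq n k
  have h2 : 0 < n.choose k := Nat.choose_pos (by omega)
  have h3 : k + 1 < n - k := by omega
  by_contra hle
  have h4 : n.choose (k + 1) * (k + 1) ≤ n.choose k * (k + 1) :=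
    Nat.mul_le_mul_right _ (not_lt.1 hle)
  have h5 : n.choose k * (k + 1) < n.choose k * (n - k) := Nat.mul_lt_mul_of_pos_left h3 h2
  omega

/-- Writing `excitations x + 1 = k` avoids truncated subtraction: for k = 0 the left side is empty.
-/
theorem card_excitations_succ_lt {k : ℕ} (h : 2 * k ≤ N) :
    Fintype.card {x : QIdx N // excitations x + 1 = k} <
      Fintype.card {x : QIdx N // excitations x = k} := by
  rw [card_excitations_eq]
  cases k with
  | zero => simp
  | succ k =>
    simp only [add_left_inj]
    rw [card_excitations_eq]
    exact choose_lt_choose_succ_of_two_mul_lt h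

theorem multDim_pos (j : SpinLabel N) : 0 < multDim j := by
  obtain ⟨k, hk⟩ : ∃ k, j.two + 2 * k = N :=
    ⟨(N - j.two) / 2, by have := j.2; have := j.1.2; simp only [SpinLabel.two]; omega⟩
  -- J₊ restricted to words with k excitations, keeping only output words with k - 1.
  let Φ : ({x : QIdx N // excitations x = k} → ℂ) →ₗ[ℂ]
      ({x : QIdx N // excitations x + 1 = k} → ℂ) :=
    LinearMap.funLeft ℂ ℂ Subtype.val ∘ₗ (Jplus N).mulVecLin ∘ₗ
      Function.ExtendByZero.linearMap ℂ Subtype.val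
  obtain ⟨u, hu, hu0⟩ := (Submodule.ne_bot_iff _).1 (LinearMap.ker_ne_bot_of_finrank_lt (f := Φ)
    (by simpa only [Module.finrank_fintype_fun_eq_card] using
      card_excitations_succ_lt (by omega)))
  let v : QSpace N := WithLp.toLp 2 (Function.extend Subtype.val u 0)
  have hvu : ∀ x : {x : QIdx N // excitations x = k}, v x = u x := fun x =>
    Subtype.val_injective.extend_apply u 0 x
  have hv0 : ∀ x : QIdx N, excitations x ≠ k → v x = 0 := fun x hx =>
    Function.extend_apply' (f := Subtype.val) u 0 x (by rintro ⟨y, rfl⟩; exact hx y.2)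
  have hz : Matrix.toEuclideanLin (Jz N) v = ((N : ℂ) / 2 - k) • v := by
    ext x
    rw [Matrix.toEuclideanLin, Matrix.toLpLin_apply]
    simp only [Jz_mulVec, PiLp.smul_apply, smul_eq_mul]
    by_cases hx : excitations x = k
    · rw [hx]
    · rw [hv0 x hx, mul_zero, mul_zero]
  have hp : Matrix.toEuclideanLin (Jplus N) v = 0 := by
    ext x
    by_contra hx
    -- By weight, J₊v can be nonzero only at the words that Φ keeps, where Φ u = 0.
    have h' := Jz_eigenvector_apply ((isSpinTriple_collective N).h_raise hz) x hx
    have h2 : ((excitations x + 1 : ℕ) : ℂ) = (k : ℕ) := by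
      push_cast
      linear_combination h'
    exact hx (congrFun (LinearMap.mem_ker.1 hu) ⟨x, by exact_mod_cast h2⟩)
  have hmem : v ∈ multSpace j := by
    refine mem_multSpace.2 ⟨hp, ?_⟩
    rw [hz]
    congr 1
    have hk' : (j.two : ℂ) + 2 * k = N := by exact_mod_cast hk
    linear_combination -hk' / 2
  have : Nontrivial (multSpace j) := by
    refine ⟨⟨⟨v, hmem⟩, 0, fun h => hu0 ?_⟩⟩
    have hv : v = 0 := congrArg Subtype.val h
    funext x
    rw [← hvu x, hv]
    rfl
  exact Module.finrank_pos

end Multiplicity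

/-! ### Permutation symmetry and invariance of block sums. -/

section Permutations

variable {N : ℕ}

theorem permOp_apply (π : Equiv.Perm (Fin N)) (x y : QIdx N) :
    permOp π x y = if x ∘ ⇑π = y then 1 else 0 := by
  have : x = y ∘ ⇑π⁻¹ ↔ x ∘ ⇑π = y :=
    ⟨fun h => by rw [h]; ext i; simp, fun h => by rw [← h]; ext i; simp⟩
  simp only [permOp, Matrix.of_apply, this]

theorem permOp_mul_apply {ι : Type*} (π : Equiv.Perm (Fin N)) (A : Matrix (QIdx N) ι ℂ)
    (x : QIdx N) (y : ι) : (permOp π * A) x y = A (x ∘ ⇑π) y := by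
  simp [Matrix.mul_apply, permOp_apply]

theorem permOp_mulVec (π : Equiv.Perm (Fin N)) (v : QIdx N → ℂ) (x : QIdx N) :
    (permOp π *ᵥ v) x = v (x ∘ ⇑π) := by
  simp [Matrix.mulVec, dotProduct, permOp_apply]

theorem mul_permOp_conjTranspose_apply (π : Equiv.Perm (Fin N)) (A : QOp N) (x y : QIdx N) :
    (A * (permOp π)ᴴ) x y = A x (y ∘ ⇑π) := by
  simp [Matrix.mul_apply, permOp_apply, Matrix.conjTranspose_apply]

theorem permOp_conj_apply (π : Equiv.Perm (Fin N)) (A : QOp N) (x y : QIdx N) :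
    (permOp π * A * (permOp π)ᴴ) x y = A (x ∘ ⇑π) (y ∘ ⇑π) := by
  rw [mul_permOp_conjTranspose_apply, permOp_mul_apply]

theorem permOp_mul_conjTranspose (π : Equiv.Perm (Fin N)) : permOp π * (permOp π)ᴴ = 1 := by
  ext x y
  rw [permOp_mul_apply, Matrix.conjTranspose_apply, permOp_apply, Matrix.one_apply]
  have : y ∘ ⇑π = x ∘ ⇑π ↔ x = y := π.surjective.injective_comp_right.eq_iff.trans eq_comm
  simp only [this]
  split_ifs <;> simp

theorem piPart_apply (ρ : QOp N) (x y : QIdx N) :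
    piPart ρ x y = (N.factorial : ℂ)⁻¹ * ∑ π : Equiv.Perm (Fin N), ρ (x ∘ ⇑π) (y ∘ ⇑π) := by
  rw [piPart, Matrix.smul_apply, Matrix.sum_apply, smul_eq_mul]
  simp only [permOp_conj_apply]

/-- Operators whose matrix entries are unchanged by a simultaneous permutation of the qubits. -/
def invariantOps (N : ℕ) : Submodule ℂ (QOp N) where
  carrier := {A | ∀ (π : Equiv.Perm (Fin N)) (x y : QIdx N), A (x ∘ ⇑π) (y ∘ ⇑π) = A x y}
  add_mem' hA hB π x y := by rw [Matrix.add_apply, hA, hB, Matrix.add_apply]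
  zero_mem' _ _ _ := rfl
  smul_mem' c A hA π x y := by rw [Matrix.smul_apply, hA, Matrix.smul_apply]

theorem mem_invariantOps {A : QOp N} : A ∈ invariantOps N ↔
    ∀ (π : Equiv.Perm (Fin N)) (x y : QIdx N), A (x ∘ ⇑π) (y ∘ ⇑π) = A x y := Iff.rfl

theorem piPart_eq_self {A : QOp N} (hA : A ∈ invariantOps N) : piPart A = A := by
  ext x y
  rw [piPart_apply, Finset.sum_congr rfl fun π _ => mem_invariantOps.1 hA π x y]
  have : (N.factorial : ℂ) ≠ 0 := Nat.cast_ne_zero.2 N.factorial_ne_zero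
  simp [Fintype.card_perm, this]

theorem isPI_iff {A : QOp N} : IsPI A ↔ A ∈ invariantOps N := by
  refine ⟨?_, fun h => ⟨A, (piPart_eq_self h).symm⟩⟩
  rintro ⟨ρ, rfl⟩ τ x y
  rw [piPart_apply, piPart_apply]
  congr 1
  exact Fintype.sum_equiv (Equiv.mulLeft τ) _ _ fun π => rfl

theorem mem_invariantOps_of_commute {A : QOp N}
    (h : ∀ π : Equiv.Perm (Fin N), permOp π * A = A * permOp π) : A ∈ invariantOps N := by
  intro π x y
  rw [← permOp_conj_apply π A, h, Matrix.mul_assoc, permOp_mul_conjTranspose, Matrix.mul_one]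

theorem isDensity_piPart {ρ : QOp N} (hρ : IsDensity ρ) : IsDensity (piPart ρ) := by
  have hfac : (N.factorial : ℂ) ≠ 0 := Nat.cast_ne_zero.2 N.factorial_ne_zero
  constructor
  · refine Matrix.PosSemidef.smul (Matrix.posSemidef_sum _ fun π _ =>
      hρ.1.mul_mul_conjTranspose_same _) ?_
    rw [← Complex.ofReal_natCast, ← Complex.ofReal_inv]
    exact_mod_cast inv_nonneg.2 (Nat.cast_nonneg (α := ℝ) _)
  · have key : ∀ π : Equiv.Perm (Fin N), (permOp π * ρ * (permOp π)ᴴ).trace = 1 := fun π => by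
      rw [Matrix.mul_assoc, Matrix.trace_mul_comm, Matrix.mul_assoc,
        mul_eq_one_comm.1 (permOp_mul_conjTranspose π), Matrix.mul_one, hρ.2]
    rw [piPart, Matrix.trace_smul, Matrix.trace_sum, Finset.sum_congr rfl fun π _ => key π]
    simp [Fintype.card_perm, hfac]

theorem permOp_mul_siteOp (π : Equiv.Perm (Fin N)) (n : Fin N) (a : Matrix (Fin 2) (Fin 2) ℂ) :
    permOp π * siteOp n a = siteOp (π n) a * permOp π := by
  refine Matrix.mulVec_injective (funext fun v => funext fun x => ?_)
  rw [← Matrix.mulVec_mulVec, ← Matrix.mulVec_mulVec]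
  simp only [siteOp_mulVec, permOp_mulVec, Function.comp_apply,
    Function.update_comp_eq_of_injective _ π.injective]

theorem permOp_mul_sum_siteOp (π : Equiv.Perm (Fin N)) (a : Matrix (Fin 2) (Fin 2) ℂ) :
    permOp π * ∑ n, siteOp n a = (∑ n, siteOp n a) * permOp π := by
  rw [Finset.mul_sum, Finset.sum_mul]
  exact Fintype.sum_equiv π _ _ fun n => permOp_mul_siteOp π n a

theorem permOp_mul_Jminus_pow (π : Equiv.Perm (Fin N)) (k : ℕ) :
    permOp π * Jminus N ^ k = Jminus N ^ k * permOp π :=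
  (Commute.pow_right (permOp_mul_sum_siteOp π _ : Commute (permOp π) (Jminus N)) k).eq

theorem permOp_mem_multSpace (π : Equiv.Perm (Fin N)) {j : SpinLabel N} {v : QSpace N}
    (hv : v ∈ multSpace j) : Matrix.toEuclideanLin (permOp π) v ∈ multSpace j := by
  obtain ⟨h1, h2⟩ := mem_multSpace.1 hv
  refine mem_multSpace.2 ⟨?_, ?_⟩
  · rw [← toEuclideanLin_mul_apply, Jplus, ← permOp_mul_sum_siteOp, ← Jplus,
      toEuclideanLin_mul_apply, h1, map_zero]
  · rw [← toEuclideanLin_mul_apply, Jz, ← permOp_mul_sum_siteOp, ← Jz,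
      toEuclideanLin_mul_apply, h2, map_smul]

/-- The matrix of `V(π)` restricted to `K_j`. -/
noncomputable def multPerm (b : MultBases N) (π : Equiv.Perm (Fin N)) (j : SpinLabel N) :
    Matrix (Fin (multDim j)) (Fin (multDim j)) ℂ :=
  Matrix.of fun β α => (b j).repr ⟨_, permOp_mem_multSpace π (b j α).2⟩ β

theorem permOp_spinState (b : MultBases N) (π : Equiv.Perm (Fin N)) (j : SpinLabel N)
    (k : Fin (j.two + 1)) (α : Fin (multDim j)) :
    Matrix.toEuclideanLin (permOp π) (spinState b ⟨j, k, α⟩) =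
      ∑ β, multPerm b π j β α • spinState b ⟨j, k, β⟩ := by
  have hsum : Matrix.toEuclideanLin (permOp π) (b j α : QSpace N) =
      ∑ β, multPerm b π j β α • (b j β : QSpace N) := by
    have := congrArg Subtype.val ((b j).sum_repr ⟨_, permOp_mem_multSpace π (b j α).2⟩)
    simpa [multPerm] using this.symm
  simp only [spinState_eq]
  rw [map_smul, ← toEuclideanLin_mul_apply, permOp_mul_Jminus_pow, toEuclideanLin_mul_apply, hsum,
    map_sum, Finset.smul_sum]
  refine Finset.sum_congr rfl fun β _ => ?_
  rw [map_smul, smul_comm]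

/-- V(π) preserves K_j and commutes with J₋, so it acts by the same matrix at every level m. -/
theorem permOp_mul_spinMap (b : MultBases N) (π : Equiv.Perm (Fin N)) :
    permOp π * spinMap b = spinMap b * Matrix.blockDiagonal' (fun j : SpinLabel N =>
      (1 : SpinOp j) ⊗ₖ multPerm b π j) := by
  ext x ⟨j, k, α⟩
  have h := congrArg (fun v : QSpace N => v x) (permOp_spinState b π j k α)
  have hl : (Matrix.toEuclideanLin (permOp π) (spinState b ⟨j, k, α⟩)) x =
      (permOp π * spinMap b) x ⟨j, k, α⟩ := by
    rw [permOp_mul_apply, Matrix.toEuclideanLin, Matrix.toLpLin_apply]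
    exact permOp_mulVec π _ x
  simp only [hl] at h
  rw [h, Matrix.mul_apply, Fintype.sum_sigma, Finset.sum_eq_single j]
  · rw [Fintype.sum_prod_type, Finset.sum_eq_single k]
    · simp [Matrix.blockDiagonal'_apply_eq, spinMap, mul_comm]
    · intro l _ hl
      simp [Matrix.blockDiagonal'_apply_eq, Matrix.one_apply_ne hl]
    · simp
  · intro i _ hi
    refine Finset.sum_eq_zero fun s _ => ?_
    rw [Matrix.blockDiagonal'_apply_ne _ _ _ hi, mul_zero]
  · simp

theorem blockSum_mem_invariantOps (b : MultBases N) (X : ∀ j : SpinLabel N, SpinOp j) :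
    blockSum b X ∈ invariantOps N := by
  refine mem_invariantOps_of_commute fun π => ?_
  let P := Matrix.blockDiagonal' fun j : SpinLabel N => (1 : SpinOp j) ⊗ₖ multPerm b π j
  have h1 : permOp π * spinMap b = spinMap b * P := permOp_mul_spinMap b π
  have h2 : P * (spinMap b)ᴴ = (spinMap b)ᴴ * permOp π := by
    calc P * (spinMap b)ᴴ = ((spinMap b)ᴴ * spinMap b) * P * (spinMap b)ᴴ := by
          rw [spinMap_conjTranspose_mul_spinMap, Matrix.one_mul]
      _ = (spinMap b)ᴴ * permOp π * (spinMap b * (spinMap b)ᴴ) := by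
          rw [Matrix.mul_assoc (spinMap b)ᴴ, ← h1]
          simp only [Matrix.mul_assoc]
      _ = _ := by rw [spinMap_mul_conjTranspose_spinMap, Matrix.mul_one]
  have h3 : P * Matrix.blockDiagonal' (fun j : SpinLabel N =>
      X j ⊗ₖ (((multDim j : ℂ)⁻¹) • (1 : Matrix (Fin (multDim j)) (Fin (multDim j)) ℂ))) =
      Matrix.blockDiagonal' (fun j : SpinLabel N =>
      X j ⊗ₖ (((multDim j : ℂ)⁻¹) • (1 : Matrix (Fin (multDim j)) (Fin (multDim j)) ℂ))) * P := by
    rw [← Matrix.blockDiagonal'_mul, ← Matrix.blockDiagonal'_mul]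
    congr 1
    funext j
    rw [← Matrix.mul_kronecker_mul, ← Matrix.mul_kronecker_mul]
    simp
  rw [blockSum, ← Matrix.mul_assoc, ← Matrix.mul_assoc, h1, Matrix.mul_assoc (spinMap b) P, h3,
    ← Matrix.mul_assoc, Matrix.mul_assoc _ P, h2, ← Matrix.mul_assoc]

end Permutations

/-! ### Dimension count. -/

section Dimension

variable {N : ℕ}

/-- Two words with the same letters, counted with multiplicity, differ by a permutation. -/
theorem exists_perm_comp_eq {ι α : Type*} [Fintype ι] {f g : ι → α}
    (h : Finset.univ.val.map f = Finset.univ.val.map g) : ∃ π : Equiv.Perm ι, g ∘ ⇑π = f := by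
  classical
  have hcard : ∀ a, Nonempty ({i // f i = a} ≃ {i // g i = a}) := fun a => by
    refine ⟨Fintype.equivOfCardEq ?_⟩
    have := congrArg (Multiset.count a) h
    rw [Multiset.count_map, Multiset.count_map] at this
    rw [Fintype.card_subtype, Fintype.card_subtype]
    simpa [Finset.card, Finset.filter, eq_comm] using this
  -- Bijections between the fibres over each letter are glued into one permutation.
  let e := fun a => (hcard a).some
  refine ⟨(Equiv.sigmaFiberEquiv f).symm.trans
    ((Equiv.sigmaCongrRight e).trans (Equiv.sigmaFiberEquiv g)), ?_⟩
  funext i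
  exact (e (f i) ⟨i, rfl⟩).2

theorem exists_word (s : Sym (Fin 2 × Fin 2) N) :
    ∃ z : Fin N → Fin 2 × Fin 2, Finset.univ.val.map z = (s : Multiset (Fin 2 × Fin 2)) := by
  obtain ⟨m, hm⟩ := s
  induction m using Quotient.inductionOn with
  | h l =>
    have hl : l.length = N := hm
    subst hl
    refine ⟨l.get, ?_⟩
    simp [Fin.univ_val_map]

/-- A pair (x, y) is a word in four letters, and an invariant entry depends only on its orbit, that
is, on its multiset of letters. -/
theorem finrank_invariantOps_le : Module.finrank ℂ (invariantOps N) ≤ (N + 3).choose 3 := by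
  choose z hz using exists_word (N := N)
  let Φ : invariantOps N →ₗ[ℂ] (Sym (Fin 2 × Fin 2) N → ℂ) :=
    { toFun := fun A s => A.1 (Prod.fst ∘ z s) (Prod.snd ∘ z s)
      map_add' := fun _ _ => rfl
      map_smul' := fun _ _ => rfl }
  have hinj : Function.Injective Φ := by
    intro A B hAB
    refine Subtype.ext (Matrix.ext fun x y => ?_)
    let s : Sym (Fin 2 × Fin 2) N := ⟨Finset.univ.val.map fun i => (x i, y i), by simp⟩
    obtain ⟨π, hπ⟩ := exists_perm_comp_eq (hz s)
    have h := congrFun hAB s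
    have hx : x ∘ ⇑π = Prod.fst ∘ z s := by rw [← hπ]; rfl
    have hy : y ∘ ⇑π = Prod.snd ∘ z s := by rw [← hπ]; rfl
    rw [← mem_invariantOps.1 A.2 π x y, ← mem_invariantOps.1 B.2 π x y, hx, hy]
    exact h
  refine (LinearMap.finrank_le_finrank_of_injective hinj).trans_eq ?_
  rw [Module.finrank_fintype_fun_eq_card, Sym.card_sym_eq_choose]
  simp only [Fintype.card_prod, Fintype.card_fin]
  rw [← Nat.choose_symm_of_eq_add (show N + 3 = N + 3 from rfl)]
  congr 1
  omega

/-- The step from n to n + 2 adds (n+3)² = C(n+4, 2) + C(n+3, 2), a sum of consecutive triangular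
numbers, which Pascal's rule also yields on the right. -/
theorem sum_sq_eq_choose (N : ℕ) :
    ∑ d ∈ Finset.range (N + 1), (if d % 2 = N % 2 then (d + 1) * (d + 1) else 0) =
      (N + 3).choose 3 := by
  induction N using Nat.twoStepInduction with
  | zero => decide
  | one => decide
  | more n ih _ =>
    rw [Finset.sum_range_succ, Finset.sum_range_succ, Nat.add_mod_right, ih, if_pos rfl,
      if_neg (by omega)]
    have h1 := Nat.choose_succ_succ (n + 4) 2
    have h2 := Nat.choose_succ_succ (n + 3) 2
    have h3 := Nat.choose_succ_succ (n + 3) 1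
    have h6 : (n + 3).choose 2 * 2 = (n + 3) * (n + 2) := by
      rw [Nat.choose_two_right]
      exact Nat.div_mul_cancel (Nat.even_mul_pred_self (n + 3)).two_dvd
    simp only [Nat.choose_one_right, Nat.succ_eq_add_one, Nat.reduceAdd] at h1 h2 h3
    have e : n + 2 + 3 = n + 4 + 1 := by ring
    rw [e, h1]
    have e' : n + 4 = n + 3 + 1 := by ring
    rw [e', h2, h3]
    nlinarith

theorem finrank_spinOps :
    Module.finrank ℂ (∀ j : SpinLabel N, SpinOp j) = (N + 3).choose 3 := by
  rw [Module.finrank_pi_fintype, ← sum_sq_eq_choose]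
  simp only [Module.finrank_matrix, Fintype.card_fin, Module.finrank_self, mul_one]
  rw [Finset.sum_range fun d => if d % 2 = N % 2 then (d + 1) * (d + 1) else 0,
    ← Finset.sum_filter]
  exact (Finset.sum_subtype (p := fun d : Fin (N + 1) => (d : ℕ) % 2 = N % 2) _ (by simp)
    fun d => ((d : ℕ) + 1) * (d + 1)).symm

end Dimension

/-! ### Block form, positivity and trace. -/

section BlockForm

variable {N : ℕ}

/-- The operator `⨁_j X_j ⊗ 𝟙 / dim K_j` in the spin basis. -/
noncomputable def spinBlocks (X : ∀ j : SpinLabel N, SpinOp j) :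
    Matrix (SpinIdx N) (SpinIdx N) ℂ :=
  Matrix.blockDiagonal' fun j : SpinLabel N =>
    X j ⊗ₖ (((multDim j : ℂ)⁻¹) • (1 : Matrix (Fin (multDim j)) (Fin (multDim j)) ℂ))

theorem blockSum_eq (b : MultBases N) (X : ∀ j : SpinLabel N, SpinOp j) :
    blockSum b X = spinMap b * spinBlocks X * (spinMap b)ᴴ := rfl

theorem spinBlocks_eq (b : MultBases N) (X : ∀ j : SpinLabel N, SpinOp j) :
    spinBlocks X = (spinMap b)ᴴ * blockSum b X * spinMap b := by
  have h := spinMap_conjTranspose_mul_spinMap b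
  rw [blockSum_eq, Matrix.mul_assoc, Matrix.mul_assoc, h, Matrix.mul_one, ← Matrix.mul_assoc, h,
    Matrix.one_mul]

theorem spinBlocks_apply (X : ∀ j : SpinLabel N, SpinOp j) (j : SpinLabel N)
    (k l : Fin (j.two + 1)) (α : Fin (multDim j)) :
    spinBlocks X ⟨j, k, α⟩ ⟨j, l, α⟩ = X j k l * (multDim j : ℂ)⁻¹ := by
  simp [spinBlocks, Matrix.blockDiagonal'_apply_eq]

theorem multDim_inv_ne_zero (j : SpinLabel N) : (multDim j : ℂ)⁻¹ ≠ 0 :=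
  inv_ne_zero (Nat.cast_ne_zero.2 (multDim_pos j).ne')

theorem multDim_inv_pos (j : SpinLabel N) : (0 : ℂ) < (multDim j : ℂ)⁻¹ := by
  rw [← Complex.ofReal_natCast, ← Complex.ofReal_inv]
  exact_mod_cast inv_pos.2 (Nat.cast_pos (α := ℝ).2 (multDim_pos j))

/-- As K_j is nonzero, X_j is visible up to a nonzero factor in the block of a single α. -/
theorem blockSum_injective (b : MultBases N) : Function.Injective (blockSum b) := by
  intro X Y h
  have h' : spinBlocks X = spinBlocks Y := by rw [spinBlocks_eq b, h, ← spinBlocks_eq]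
  funext j
  ext k l
  have h2 := congrFun (congrFun h' ⟨j, k, ⟨0, multDim_pos j⟩⟩) ⟨j, l, ⟨0, multDim_pos j⟩⟩
  rw [spinBlocks_apply, spinBlocks_apply] at h2
  exact mul_right_cancel₀ (multDim_inv_ne_zero j) h2

/-- `blockSum` as a linear map into the permutationally invariant operators. -/
noncomputable def blockSumLin (b : MultBases N) :
    (∀ j : SpinLabel N, SpinOp j) →ₗ[ℂ] invariantOps N where
  toFun X := ⟨blockSum b X, blockSum_mem_invariantOps b X⟩
  map_add' X Y := by
    refine Subtype.ext ?_
    have : spinBlocks (X + Y) = spinBlocks X + spinBlocks Y := by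
      rw [spinBlocks, spinBlocks, spinBlocks, ← Matrix.blockDiagonal'_add]
      congr 1
      funext j
      exact Matrix.add_kronecker _ _ _
    simp only [Submodule.coe_add, blockSum_eq, this, Matrix.mul_add, Matrix.add_mul]
  map_smul' c X := by
    refine Subtype.ext ?_
    have : spinBlocks (c • X) = c • spinBlocks X := by
      rw [spinBlocks, spinBlocks, ← Matrix.blockDiagonal'_smul]
      congr 1
      funext j
      exact Matrix.smul_kronecker c (X j) _
    simp only [Submodule.coe_smul, blockSum_eq, this, Matrix.mul_smul, Matrix.smul_mul,
      RingHom.id_apply]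

/-- The two dimension bounds meet, so the injective map `blockSumLin b` is onto. -/
theorem exists_eq_blockSum (b : MultBases N) {A : QOp N} (hA : A ∈ invariantOps N) :
    ∃ X : ∀ j : SpinLabel N, SpinOp j, A = blockSum b X := by
  have hinj : Function.Injective (blockSumLin b) := fun X Y h =>
    blockSum_injective b (congrArg Subtype.val h)
  have hdim : Module.finrank ℂ (∀ j : SpinLabel N, SpinOp j) =
      Module.finrank ℂ (invariantOps N) :=
    le_antisymm (LinearMap.finrank_le_finrank_of_injective hinj)
      (finrank_invariantOps_le.trans_eq finrank_spinOps.symm)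
  obtain ⟨X, hX⟩ :=
    (LinearMap.injective_iff_surjective_of_finrank_eq_finrank hdim).1 hinj ⟨A, hA⟩
  exact ⟨X, (congrArg Subtype.val hX).symm⟩

open scoped MatrixOrder in
theorem posSemidef_blockDiagonal' {ι : Type*} [Fintype ι] [DecidableEq ι] {m : ι → Type*}
    [∀ i, Fintype (m i)] {M : ∀ i, Matrix (m i) (m i) ℂ} (hM : ∀ i, (M i).PosSemidef) :
    (Matrix.blockDiagonal' M).PosSemidef := by
  classical
  choose B hB using fun i => CStarAlgebra.nonneg_iff_eq_star_mul_self.1 (hM i).nonneg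
  have : Matrix.blockDiagonal' M =
      (Matrix.blockDiagonal' B)ᴴ * Matrix.blockDiagonal' B := by
    rw [Matrix.blockDiagonal'_conjTranspose, ← Matrix.blockDiagonal'_mul]
    exact congrArg _ (funext hB)
  rw [this]
  exact Matrix.posSemidef_conjTranspose_mul_self _

theorem posSemidef_smul_iff {ι : Type*} [Fintype ι] {M : Matrix ι ι ℂ} {c : ℝ} (hc : 0 < c) :
    ((c : ℂ) • M).PosSemidef ↔ M.PosSemidef := by
  have aux : ∀ {c : ℝ}, 0 < c → ∀ {M : Matrix ι ι ℂ}, M.PosSemidef → ((c : ℂ) • M).PosSemidef :=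
    fun hc _ hM => hM.smul (by exact_mod_cast hc.le)
  refine ⟨fun h => ?_, aux hc⟩
  have := aux (inv_pos.2 hc) h
  rwa [smul_smul, ← Complex.ofReal_mul, inv_mul_cancel₀ hc.ne', Complex.ofReal_one,
    one_smul] at this

theorem posSemidef_blockSum_iff (b : MultBases N) (X : ∀ j : SpinLabel N, SpinOp j) :
    (blockSum b X).PosSemidef ↔ ∀ j, (X j).PosSemidef := by
  constructor
  · intro h j
    have h1 : (spinBlocks X).PosSemidef := by
      rw [spinBlocks_eq b]
      exact h.conjTranspose_mul_mul_same _
    -- Compression to the first basis vector of K_j leaves X_j / dim K_j.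
    have h2 := h1.submatrix fun k : Fin (j.two + 1) =>
      (⟨j, k, ⟨0, multDim_pos j⟩⟩ : SpinIdx N)
    have h3 := h2.smul (Nat.cast_nonneg (α := ℂ) (multDim j))
    convert h3 using 1
    ext k l
    rw [Matrix.smul_apply, Matrix.submatrix_apply, spinBlocks_apply, smul_eq_mul, mul_left_comm,
      mul_inv_cancel₀ (Nat.cast_ne_zero.2 (multDim_pos j).ne'), mul_one]
  · intro h
    rw [blockSum_eq]
    refine Matrix.PosSemidef.mul_mul_conjTranspose_same (posSemidef_blockDiagonal' fun j => ?_) _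
    exact (h j).kronecker (Matrix.PosSemidef.one.smul (multDim_inv_pos j).le)

theorem trace_blockSum (b : MultBases N) (X : ∀ j : SpinLabel N, SpinOp j) :
    (blockSum b X).trace = ∑ j, (X j).trace := by
  rw [blockSum_eq, Matrix.mul_assoc, Matrix.trace_mul_comm, Matrix.mul_assoc,
    spinMap_conjTranspose_mul_spinMap, Matrix.mul_one, spinBlocks, Matrix.trace_blockDiagonal']
  refine Finset.sum_congr rfl fun j _ => ?_
  have : (multDim j : ℂ) ≠ 0 := Nat.cast_ne_zero.2 (multDim_pos j).ne'
  rw [Matrix.trace_kronecker, Matrix.trace_smul, Matrix.trace_one, Fintype.card_fin, smul_eq_mul,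
    inv_mul_cancel₀ this, mul_one]

theorem isDensity_blockSum_iff (b : MultBases N) (X : ∀ j : SpinLabel N, SpinOp j) :
    IsDensity (blockSum b X) ↔ (∀ j, (X j).PosSemidef) ∧ ∑ j, (X j).trace = 1 := by
  rw [IsDensity, posSemidef_blockSum_iff, trace_blockSum]

theorem isDensity_blockSum_smul_iff (b : MultBases N) (p : SpinLabel N → ℝ)
    (σ : ∀ j : SpinLabel N, SpinOp j) (hσ : ∀ j, (σ j).trace = 1) :
    IsDensity (blockSum b fun j => (p j : ℂ) • σ j) ↔
      IsProbDist p ∧ ∀ j, p j ≠ 0 → IsDensity (σ j) := by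
  rw [isDensity_blockSum_iff]
  simp only [Matrix.trace_smul, hσ, smul_eq_mul, mul_one]
  constructor
  · rintro ⟨hpos, hsum⟩
    have hp : ∀ j, 0 ≤ p j := fun j => by
      have := (hpos j).trace_nonneg
      rw [Matrix.trace_smul, hσ, smul_eq_mul, mul_one] at this
      exact_mod_cast this
    exact ⟨⟨hp, by exact_mod_cast hsum⟩, fun j hj =>
      ⟨(posSemidef_smul_iff ((hp j).lt_of_ne' hj)).1 (hpos j), hσ j⟩⟩
  · rintro ⟨⟨hp, hsum⟩, hd⟩
    refine ⟨fun j => ?_, by exact_mod_cast hsum⟩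
    by_cases hj : p j = 0
    · rw [hj, Complex.ofReal_zero, zero_smul]
      exact Matrix.PosSemidef.zero
    · exact (posSemidef_smul_iff ((hp j).lt_of_ne' hj)).2 (hd j hj).1

/-- A positive semidefinite operator is a nonnegative multiple of a density operator. -/
theorem exists_density_smul_eq {n : ℕ} {X : Matrix (Fin (n + 1)) (Fin (n + 1)) ℂ}
    (hX : X.PosSemidef) :
    ∃ (p : ℝ) (σ : Matrix (Fin (n + 1)) (Fin (n + 1)) ℂ), IsDensity σ ∧ X = (p : ℂ) • σ := by
  have hre : ((X.trace.re : ℝ) : ℂ) = X.trace :=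
    (Complex.eq_re_of_ofReal_le (r := 0) (by simpa using hX.trace_nonneg)).symm
  have hnn : 0 ≤ X.trace.re := (Complex.le_def.1 hX.trace_nonneg).1
  by_cases h0 : X.trace = 0
  -- Trace zero forces X = 0; the density operator is then arbitrary, here the projector onto the
  -- first basis vector.
  · refine ⟨0, Matrix.diagonal (Pi.single 0 1), ⟨Matrix.PosSemidef.diagonal ?_, ?_⟩, ?_⟩
    · exact Pi.single_nonneg.2 zero_le_one
    · rw [Matrix.trace_diagonal, Finset.sum_pi_single']
      simp
    · rw [hX.trace_eq_zero_iff.1 h0, Complex.ofReal_zero, zero_smul]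
  · have hne : X.trace.re ≠ 0 := fun h => h0 (by rw [← hre, h, Complex.ofReal_zero])
    have hpos : 0 < X.trace.re := lt_of_le_of_ne hnn hne.symm
    refine ⟨X.trace.re, ((X.trace.re⁻¹ : ℝ) : ℂ) • X,
      ⟨(posSemidef_smul_iff (inv_pos.2 hpos)).2 hX, ?_⟩, ?_⟩
    · rw [Matrix.trace_smul, Complex.ofReal_inv, hre, smul_eq_mul, inv_mul_cancel₀ h0]
    · rw [smul_smul, ← Complex.ofReal_mul, mul_inv_cancel₀ hne, Complex.ofReal_one, one_smul]

theorem isDensity_iff_exists_ensemble (b : MultBases N) {A : QOp N} (hA : A ∈ invariantOps N) :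
    IsDensity A ↔ ∃ (p : SpinLabel N → ℝ) (σ : ∀ j : SpinLabel N, SpinOp j),
      IsProbDist p ∧ (∀ j, IsDensity (σ j)) ∧ A = blockSum b (fun j => (p j : ℂ) • σ j) := by
  constructor
  · intro hd
    obtain ⟨X, rfl⟩ := exists_eq_blockSum b hA
    choose p σ hσ hX using fun j =>
      exists_density_smul_eq (((isDensity_blockSum_iff b X).1 hd).1 j)
    obtain rfl : X = fun j => (p j : ℂ) • σ j := funext hX
    exact ⟨p, σ, ((isDensity_blockSum_smul_iff b p σ fun j => (hσ j).2).1 hd).1, hσ, rfl⟩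
  · rintro ⟨p, σ, hp, hσ, rfl⟩
    exact (isDensity_blockSum_smul_iff b p σ fun j => (hσ j).2).2 ⟨hp, fun j _ => hσ j⟩

end BlockForm

theorem proposition1 (N : ℕ) (b : MultBases N) :
    -- `(ℂ²)^{⊗N} = ⨁_j H_j ⊗ K_j`: the identification is unitary, and every `K_j` is nonzero
    ((spinMap b)ᴴ * spinMap b = 1 ∧ spinMap b * (spinMap b)ᴴ = 1 ∧
      ∀ j : SpinLabel N, 0 < multDim j) ∧
    -- every permutationally invariant state has the block form
    (∀ ρ : QOp N, IsDensity ρ →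
      ∃ (p : SpinLabel N → ℝ) (σ : ∀ j : SpinLabel N, SpinOp j),
        IsProbDist p ∧ (∀ j, IsDensity (σ j)) ∧
        piPart ρ = blockSum b (fun j => (p j : ℂ) • σ j)) ∧
    -- permutationally invariant operators correspond bijectively to their ensembles
    (∀ A : QOp N, IsPI A → ∃! X : ∀ j : SpinLabel N, SpinOp j, A = blockSum b X) ∧
    (∀ X : ∀ j : SpinLabel N, SpinOp j, IsPI (blockSum b X)) ∧
    -- characterization of the density operators among the permutationally invariant operators
    (∀ A : QOp N, IsPI A →
      (IsDensity A ↔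
        ∃ (p : SpinLabel N → ℝ) (σ : ∀ j : SpinLabel N, SpinOp j),
          IsProbDist p ∧ (∀ j, IsDensity (σ j)) ∧
          A = blockSum b (fun j => (p j : ℂ) • σ j))) ∧
    -- the same for a given ensemble; `σ j` is immaterial where `p j = 0`
    (∀ (p : SpinLabel N → ℝ) (σ : ∀ j : SpinLabel N, SpinOp j), (∀ j, (σ j).trace = 1) →
      (IsDensity (blockSum b (fun j => (p j : ℂ) • σ j)) ↔
        IsProbDist p ∧ ∀ j, p j ≠ 0 → IsDensity (σ j))) := by
  refine ⟨⟨spinMap_conjTranspose_mul_spinMap b, spinMap_mul_conjTranspose_spinMap b, multDim_pos⟩,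
    fun ρ hρ => ?_, fun A hA => ?_, fun X => isPI_iff.2 (blockSum_mem_invariantOps b X),
    fun A hA => isDensity_iff_exists_ensemble b (isPI_iff.1 hA), isDensity_blockSum_smul_iff b⟩
  · exact (isDensity_iff_exists_ensemble b (isPI_iff.1 ⟨ρ, rfl⟩)).1 (isDensity_piPart hρ)
  · obtain ⟨X, hX⟩ := exists_eq_blockSum b (isPI_iff.1 hA)
    exact ⟨X, hX, fun Y hY => blockSum_injective b (hY.symm.trans hX)⟩
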